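/- Let $p$ be a selective ultrafilter on $\omega$, that is, a free ultrafilter such that for every partition $(P_c)_{c\in\omega}$ of $\omega$ (empty pieces allowed) with $P_c\notin p$ for all $c$, there is $B\in p$ with $|B\cap P_c|\le 1$ for all $c$. Then the additive group $\mathbb R$ admits a Hausdorff group topology that is $p$-compact (for every sequence $(x_n)_{n\in\omega}$ there is a point $x$ such that $\{n\in\omega : x_n\in U\}\in p$ for every open $U\ni x$) and has no non-trivial convergent sequences (every convergent sequence is eventually equal to its limit). -/

import Mathlib

open Filter Topology

/-- A selective (Ramsey) ultrafilter on `ℕ`: a free ultrafilter such that for every partition of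
`ℕ` (given as the family of fibres of a function `f`) into pieces that do not belong to `p`,
some member of `p` meets each piece in at most one point. -/
def IsSelective (p : Ultrafilter ℕ) : Prop :=
  (∀ n : ℕ, ({n} : Set ℕ) ∉ p) ∧
    ∀ f : ℕ → ℕ, (∀ c : ℕ, f ⁻¹' {c} ∉ p) → ∃ B ∈ p, Set.InjOn f B

/-- The point `x` is a `p`-limit of the sequence `u`. -/
def IsPLimit {X : Type*} [TopologicalSpace X] (p : Ultrafilter ℕ) (u : ℕ → X) (x : X) : Prop :=
  ∀ U : Set X, IsOpen U → x ∈ U → {n : ℕ | u n ∈ U} ∈ p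

/-- A space is `p`-compact if every sequence in it has a `p`-limit. -/
def IsPCompactSpace (X : Type*) [TopologicalSpace X] (p : Ultrafilter ℕ) : Prop :=
  ∀ u : ℕ → X, ∃ x : X, IsPLimit p u x

/-- A space has no non-trivial convergent sequences if every convergent sequence
is eventually equal to its limit. -/
def NoNontrivialConvergentSeq (X : Type*) [TopologicalSpace X] : Prop :=
  ∀ (u : ℕ → X) (x : X), Tendsto u atTop (𝓝 x) → ∀ᶠ n in atTop, u n = x

/-!
View `V = ℝ` as a rational vector space and let `S = Hom(ℚ, ℝ/ℤ)` be the rational solenoid, a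
compact group on which `ℚ` acts. Evaluation embeds `V` into the compact group of all functions
`(V →ₗ[ℚ] S) → S`. Closing the image of `V` under pointwise `p`-limits of sequences gives a rational
vector space `iterLimit p V` of cardinality continuum (`iterLimit.mk_le`), hence an isomorphic copy
of `ℝ`. With the topology of pointwise convergence it is a Hausdorff group, and it is `p`-compact by
construction.

It has no nontrivial convergent sequence (`iterLimit.noNontrivialConvergentSeq`). Otherwise there
would be an injective sequence `y` tending to `0`. Building the terms of `y` involves countably many
`p`-limits; if a linear map `Φ : iterLimit p V → S` respects these, the function `y m` takes the
value `Φ (y m)` at the point `Φ|V` of the dual of `V` (`iterLimit.exists_countable`). As convergence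
in `iterLimit p V` is pointwise, it suffices to find `Φ` that respects countably many given
`p`-limits while `Φ (y m)` does not tend to `0`
(`IsSelective.exists_addMonoidHom_tendsto_zero`).

Such a `Φ` is built by successive approximation. By a quantitative form of Kronecker's theorem
(`exists_addMonoidHom_norm_sub_lt`), the obstructions to prescribing approximate values of a
character at finitely many vectors are finitely many linear relations with small integer
coefficients. A relation involving terms of `p`-null sequences that persists for `p`-almost all
indices forces its constant part to vanish, so it obstructs nothing; each of the others
disappears on a member of `p`. Thus every round of the construction can be carried out for
`p`-almost all indices, and selectivity, in the form of a game
(`IsSelective.exists_strictMono_run`), provides a member of `p` all of whose elements are used.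
-/

/-! ### A quantitative Kronecker theorem -/

open MeasureTheory AddCircle in
lemma integral_fourier_eq_ite (n : ℤ) :
    ∫ θ : UnitAddCircle, fourier n θ ∂haarAddCircle = if n = 0 then 1 else 0 := by
  have h := congrFun (fourierCoeff_fourier (T := (1 : ℝ)) n) 0
  simp only [fourierCoeff, neg_zero, fourier_zero, one_smul] at h
  rw [h, Pi.single_apply]
  simp [eq_comm]

open MeasureTheory AddCircle ComplexConjugate in
/-- Expanding the square, only the pairs `(a, b)` of equal frequency survive integration; on these
the phases agree, so that they contribute the nonnegative amount `c a * c b`. -/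
lemma sum_sq_le_integral_norm_sq {α : Type*} [Fintype α] (c : α → ℝ) (hc : ∀ a, 0 ≤ c a)
    (m : α → ℤ) (s : α → UnitAddCircle) (hs : ∀ a b, m a = m b → s a = s b) :
    ∑ a, c a ^ 2 ≤ ∫ θ : UnitAddCircle,
      ‖∑ a, (c a : ℂ) * (toCircle (m a • θ - s a) : ℂ)‖ ^ 2 ∂haarAddCircle := by
  classical
  have key : ∀ θ : UnitAddCircle,
      ((‖∑ a, (c a : ℂ) * (toCircle (m a • θ - s a) : ℂ)‖ ^ 2 : ℝ) : ℂ) =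
      ∑ a, ∑ b, ((c a * c b : ℝ) : ℂ) * (toCircle (s b - s a) : ℂ) * fourier (m a - m b) θ := by
    intro θ
    rw [Complex.ofReal_pow, ← Complex.mul_conj', map_sum, Finset.sum_mul_sum]
    refine Finset.sum_congr rfl fun a _ ↦ Finset.sum_congr rfl fun b _ ↦ ?_
    have h1 : toCircle (m a • θ - s a) * (toCircle (m b • θ - s b))⁻¹ =
        toCircle (s b - s a) * toCircle ((m a - m b) • θ) := by
      rw [← toCircle_neg, ← toCircle_add, ← toCircle_add]
      congr 1
      rw [sub_smul]
      abel
    have h2 : (toCircle (m a • θ - s a) : ℂ) * conj (toCircle (m b • θ - s b) : ℂ) =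
        (toCircle (s b - s a) : ℂ) * (toCircle ((m a - m b) • θ) : ℂ) := by
      rw [← Circle.coe_inv_eq_conj, ← Circle.coe_mul, h1, Circle.coe_mul]
    rw [map_mul, Complex.conj_ofReal, fourier_apply]
    push_cast
    linear_combination ((c a : ℂ) * c b) * h2
  have hI : ((∫ θ : UnitAddCircle,
      ‖∑ a, (c a : ℂ) * (toCircle (m a • θ - s a) : ℂ)‖ ^ 2 ∂haarAddCircle : ℝ) : ℂ) =
      ((∑ a, ∑ b, if m a = m b then c a * c b else 0 : ℝ) : ℂ) := by
    rw [← integral_complex_ofReal]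
    simp_rw [key]
    have hint : ∀ a b, Integrable (fun θ : UnitAddCircle ↦ ((c a * c b : ℝ) : ℂ) *
        (toCircle (s b - s a) : ℂ) * fourier (m a - m b) θ) haarAddCircle := fun a b ↦
      (Continuous.integrable_of_hasCompactSupport (by fun_prop)
        (HasCompactSupport.of_compactSpace _))
    rw [integral_finsetSum _ fun a _ ↦ integrable_finsetSum _ fun b _ ↦ hint a b]
    rw [Complex.ofReal_sum]
    refine Finset.sum_congr rfl fun a _ ↦ ?_
    rw [integral_finsetSum _ fun b _ ↦ hint a b, Complex.ofReal_sum]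
    refine Finset.sum_congr rfl fun b _ ↦ ?_
    rw [integral_const_mul, integral_fourier_eq_ite]
    by_cases h : m a = m b
    · simp [h, hs a b h]
    · simp [h, sub_eq_zero]
  rw [Complex.ofReal_inj] at hI
  rw [hI]
  refine Finset.sum_le_sum fun a _ ↦ ?_
  refine le_trans (by simp [sq]) (Finset.single_le_sum (f := fun b ↦ if m a = m b then c a * c b
    else 0) (fun b _ ↦ ?_) (Finset.mem_univ a))
  positivity [hc a, hc b]

open AddCircle in
/-- Binomial expansion of the kernel `∏ i, ((1 + e(x i)) / 2) ^ M`, where `e` is `toCircle`. Its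
coefficients are nonnegative and its modulus is small as soon as one `x i` is far from `0`. -/
lemma prod_half_one_add_toCircle_pow {ι : Type*} [Fintype ι] [DecidableEq ι] (M : ℕ)
    (x : ι → UnitAddCircle) :
    ∏ i, (((1 : ℂ) + toCircle (x i)) / 2) ^ M =
      ∑ a : ι → Fin (M + 1), ((∏ i, (M.choose (a i) : ℝ) / 2 ^ M : ℝ) : ℂ) *
        (toCircle (∑ i, ((a i : ℕ) : ℤ) • x i) : ℂ) := by
  have h1 : ∀ i, (((1 : ℂ) + toCircle (x i)) / 2) ^ M =
      ∑ a : Fin (M + 1), ((M.choose a : ℂ) / 2 ^ M) * (toCircle (((a : ℕ) : ℤ) • x i) : ℂ) := by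
    intro i
    rw [div_pow, add_comm, add_pow, Finset.sum_range, Finset.sum_div]
    refine Finset.sum_congr rfl fun a _ ↦ ?_
    rw [toCircle_zsmul, zpow_natCast, Circle.coe_pow, one_pow]
    ring
  have h2 : ∀ y : ι → UnitAddCircle, (toCircle (∑ i, y i) : ℂ) = ∏ i, (toCircle (y i) : ℂ) := by
    intro y
    have : ∀ s : Finset ι, (toCircle (∑ i ∈ s, y i) : ℂ) = ∏ i ∈ s, (toCircle (y i) : ℂ) := by
      intro s
      induction s using Finset.induction_on with
      | empty => simp
      | insert i s hi ih => rw [Finset.sum_insert hi, Finset.prod_insert hi, toCircle_add,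
          Circle.coe_mul, ih]
    exact this _
  simp_rw [h1]
  rw [Finset.prod_univ_sum, Fintype.piFinset_univ]
  refine Finset.sum_congr rfl fun a _ ↦ ?_
  rw [h2, Finset.prod_mul_distrib]
  push_cast
  rfl

open AddCircle in
lemma norm_half_one_add_toCircle_le_one (x : UnitAddCircle) :
    ‖((1 : ℂ) + toCircle x) / 2‖ ≤ 1 := by
  rw [norm_div]
  have := norm_add_le (1 : ℂ) (toCircle x)
  rw [norm_one, Circle.norm_coe] at this
  simp only [Complex.norm_ofNat]
  linarith

open AddCircle in
lemma exists_norm_half_one_add_toCircle_le (ε : ℝ) (hε : 0 < ε) :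
    ∃ ρ : ℝ, 0 ≤ ρ ∧ ρ < 1 ∧ ∀ x : UnitAddCircle, ε ≤ ‖x‖ →
      ‖((1 : ℂ) + toCircle x) / 2‖ ≤ ρ := by
  have hcont : Continuous fun x : UnitAddCircle ↦ ‖((1 : ℂ) + toCircle x) / 2‖ := by
    have := continuous_toCircle (T := (1 : ℝ))
    fun_prop
  have hcpt : IsCompact {x : UnitAddCircle | ε ≤ ‖x‖} :=
    (isClosed_le continuous_const continuous_norm).isCompact
  rcases Set.eq_empty_or_nonempty {x : UnitAddCircle | ε ≤ ‖x‖} with h | h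
  · exact ⟨0, le_rfl, one_pos, fun x hx ↦ absurd (show x ∈ {x : UnitAddCircle | ε ≤ ‖x‖} from hx)
      (by simp [h])⟩
  obtain ⟨x₀, hx₀, hmax⟩ := hcpt.exists_isMaxOn h hcont.continuousOn
  refine ⟨_, norm_nonneg _, ?_, fun x hx ↦ hmax hx⟩
  refine lt_of_le_of_ne (norm_half_one_add_toCircle_le_one x₀) fun heq ↦ ?_
  have h2 : ‖(1 : ℂ) + toCircle x₀‖ = ‖(1 : ℂ)‖ + ‖(toCircle x₀ : ℂ)‖ := by
    rw [norm_div, Complex.norm_ofNat, div_eq_one_iff_eq two_ne_zero] at heq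
    rw [heq, norm_one, Circle.norm_coe]
    norm_num
  have h3 : (1 : ℂ) = toCircle x₀ := eq_of_norm_eq_of_norm_add_eq
    (by rw [norm_one, Circle.norm_coe]) h2
  have h4 : x₀ = 0 := by
    apply injective_toCircle one_ne_zero
    rw [toCircle_zero]
    exact Circle.ext h3.symm
  have : ε ≤ ‖x₀‖ := hx₀
  rw [h4, norm_zero] at this
  linarith

lemma exists_ratLinear_apply_ne_zero {X : Type*} [AddCommGroup X] [Module ℚ X] (D : Finset X)
    (hD : ∀ d ∈ D, d ≠ 0) : ∃ l : X →ₗ[ℚ] ℚ, ∀ d ∈ D, l d ≠ 0 := by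
  obtain ⟨l, hl⟩ := Module.exists_dual_forall_apply_ne_zero (K := ℚ) (fun d : D ↦ (d : X))
    (fun d ↦ hD d d.2)
  exact ⟨l, fun d hd ↦ hl ⟨d, hd⟩⟩

lemma exists_intCast_eq_mul {ι : Type*} [Fintype ι] (q : ι → ℚ) :
    ∃ N : ℕ, N ≠ 0 ∧ ∃ m : ι → ℤ, ∀ i, (m i : ℚ) = N * q i := by
  refine ⟨∏ i, (q i).den, Finset.prod_ne_zero_iff.2 fun i _ ↦ (q i).den_ne_zero, ?_⟩
  have : ∀ i, ∃ m : ℤ, (m : ℚ) = (∏ i, (q i).den : ℕ) * q i := by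
    intro i
    obtain ⟨k, hk⟩ := Finset.dvd_prod_of_mem (fun i ↦ (q i).den) (Finset.mem_univ i)
    refine ⟨k * (q i).num, ?_⟩
    have h0 := Rat.mul_den_eq_num (q i)
    rw [hk]
    push_cast
    linear_combination -(k : ℚ) * h0
  choose m hm using this
  exact ⟨m, hm⟩

/-- A rational functional `l` and a point `θ` of the circle induce a character: for a real lift `τ`
of `θ` it is `x ↦ l x * τ` modulo `1`, hence an integer multiple of `θ` wherever `l` is integral. -/
lemma exists_addMonoidHom_eq_zsmul {X : Type*} [AddCommGroup X] [Module ℚ X] (l : X →ₗ[ℚ] ℚ)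
    (θ : UnitAddCircle) : ∃ φ : X →+ UnitAddCircle, ∀ (x : X) (m : ℤ), (m : ℚ) = l x →
      φ x = m • θ := by
  induction θ using QuotientAddGroup.induction_on with
  | H τ =>
    refine ⟨(QuotientAddGroup.mk' _).comp ((AddMonoidHom.mulRight τ).comp
      ((Rat.castHom ℝ).toAddMonoidHom.comp l.toAddMonoidHom)), fun x m hm ↦ ?_⟩
    have : ((l x : ℚ) : ℝ) = m := by rw [← hm]; simp
    change ((((l x : ℚ) : ℝ) * τ : ℝ) : UnitAddCircle) = m • (τ : UnitAddCircle)
    rw [this, ← AddCircle.coe_zsmul, zsmul_eq_mul]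

open AddCircle MeasureTheory in
/-- Kronecker's theorem with bounded coefficients: prescribed values `t i` at vectors `u i` of a
rational vector space can be approximated by a character as soon as they satisfy every integer
relation between the `u i` whose coefficients are at most `M`, and `M` depends only on the number
of vectors and on the precision. -/
lemma exists_addMonoidHom_norm_sub_lt (ι : Type*) [Fintype ι] (ε : ℝ) (hε : 0 < ε) :
    ∃ M : ℕ, ∀ {X : Type*} [AddCommGroup X] [Module ℚ X] (u : ι → X) (t : ι → UnitAddCircle),
      (∀ a : ι → ℤ, (∀ i, |a i| ≤ M) → ∑ i, a i • u i = 0 → ∑ i, a i • t i = 0) →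
      ∃ φ : X →+ UnitAddCircle, ∀ i, ‖φ (u i) - t i‖ < ε := by
  classical
  obtain ⟨ρ, hρ0, hρ1, hρ⟩ := exists_norm_half_one_add_toCircle_le ε hε
  obtain ⟨M, hM⟩ : ∃ M : ℕ, ((M : ℝ) + 1) ^ Fintype.card ι * (ρ ^ M) ^ 2 < 1 := by
    have h1 : |ρ ^ 2| < 1 := by
      rw [abs_of_nonneg (by positivity)]
      nlinarith
    have h2 := tendsto_pow_const_mul_const_pow_of_abs_lt_one (Fintype.card ι) h1
    obtain ⟨M, hlt, hM1⟩ := ((h2.const_mul (2 ^ Fintype.card ι : ℝ)).eventually_lt_const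
      (by rw [mul_zero]; exact one_pos)).and (eventually_ge_atTop 1) |>.exists
    refine ⟨M, lt_of_le_of_lt ?_ hlt⟩
    have hM1' : (1 : ℝ) ≤ M := by exact_mod_cast hM1
    calc ((M : ℝ) + 1) ^ Fintype.card ι * (ρ ^ M) ^ 2
        ≤ (2 * M) ^ Fintype.card ι * (ρ ^ M) ^ 2 := by gcongr; linarith
      _ = 2 ^ Fintype.card ι * ((M : ℝ) ^ Fintype.card ι * (ρ ^ 2) ^ M) := by ring
  refine ⟨M, fun {X} _ _ u t hrel ↦ ?_⟩
  -- a linear functional separating all the small combinations of the `u i` from zero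
  obtain ⟨l, hl⟩ := exists_ratLinear_apply_ne_zero
    (((Fintype.piFinset fun _ : ι ↦ Finset.Icc (-(M : ℤ)) M).image
      fun a ↦ ∑ i, a i • u i).erase 0) (fun d hd ↦ Finset.ne_of_mem_erase hd)
  obtain ⟨N, hN, m, hm⟩ := exists_intCast_eq_mul fun i ↦ l (u i)
  by_contra! hcon
  -- every character `θ ↦ m i • θ` fails, so the kernel is at most `ρ ^ M` on the whole circle,
  -- while its mean square is at least `(M + 1) ^ (-|ι|)`
  have hbad : ∀ θ : UnitAddCircle, ∃ i, ε ≤ ‖m i • θ - t i‖ := by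
    intro θ
    obtain ⟨φ, hφ⟩ := exists_addMonoidHom_eq_zsmul ((N : ℚ) • l) θ
    obtain ⟨i, hi⟩ := hcon φ
    refine ⟨i, ?_⟩
    rwa [← hφ (u i) (m i) (by simp [hm])]
  have hfac : ∀ (a b : ι → Fin (M + 1)), ∑ i, ((a i : ℕ) : ℤ) * m i = ∑ i, ((b i : ℕ) : ℤ) * m i →
      ∑ i, ((a i : ℕ) : ℤ) • t i = ∑ i, ((b i : ℕ) : ℤ) • t i := by
    intro a b hab
    have hle : ∀ i, |((a i : ℕ) : ℤ) - ((b i : ℕ) : ℤ)| ≤ M := fun i ↦ by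
      have := (a i).2
      have := (b i).2
      rw [abs_le]
      omega
    have := hrel (fun i ↦ ((a i : ℕ) : ℤ) - ((b i : ℕ) : ℤ)) hle ?_
    · simp_rw [sub_smul] at this
      rwa [Finset.sum_sub_distrib, sub_eq_zero] at this
    · by_contra hne
      refine hl _ (Finset.mem_erase.2 ⟨hne, Finset.mem_image_of_mem _
        (Fintype.mem_piFinset.2 fun i ↦ Finset.mem_Icc.2 (abs_le.1 (hle i)))⟩) ?_
      have hN' : (N : ℚ) ≠ 0 := by exact_mod_cast hN
      refine (mul_eq_zero.1 (?_ : (N : ℚ) * _ = 0)).resolve_left hN'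
      have hab' : ((∑ i, ((a i : ℕ) : ℤ) * m i : ℤ) : ℚ) = ((∑ i, ((b i : ℕ) : ℤ) * m i : ℤ) : ℚ) :=
        by rw [hab]
      rw [map_sum, Finset.mul_sum]
      simp_rw [map_zsmul]
      push_cast at hab'
      simp_rw [hm] at hab'
      rw [← sub_eq_zero, ← Finset.sum_sub_distrib] at hab'
      rw [← hab']
      refine Finset.sum_congr rfl fun i _ ↦ ?_
      simp only [zsmul_eq_mul]
      push_cast
      ring
  have hlow := sum_sq_le_integral_norm_sq (α := ι → Fin (M + 1))
    (fun a ↦ ∏ i, (M.choose (a i) : ℝ) / 2 ^ M) (fun a ↦ by positivity)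
    (fun a ↦ ∑ i, ((a i : ℕ) : ℤ) * m i) (fun a ↦ ∑ i, ((a i : ℕ) : ℤ) • t i) hfac
  have hone : ∑ a : ι → Fin (M + 1), ∏ i, (M.choose (a i) : ℝ) / 2 ^ M = 1 := by
    have := prod_half_one_add_toCircle_pow M (fun _ : ι ↦ (0 : UnitAddCircle))
    simp only [smul_zero, Finset.sum_const_zero, toCircle_zero, Circle.coe_one, mul_one] at this
    rw [add_self_div_two, Finset.prod_const, one_pow, one_pow] at this
    exact_mod_cast this.symm
  have hcs := sq_sum_le_card_mul_sum_sq (s := Finset.univ)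
    (f := fun a : ι → Fin (M + 1) ↦ ∏ i, (M.choose (a i) : ℝ) / 2 ^ M)
  rw [hone] at hcs
  have hup : ∀ θ : UnitAddCircle, ‖∑ a : ι → Fin (M + 1),
      ((∏ i, (M.choose (a i) : ℝ) / 2 ^ M : ℝ) : ℂ) *
      (toCircle ((∑ i, ((a i : ℕ) : ℤ) * m i) • θ - ∑ i, ((a i : ℕ) : ℤ) • t i) : ℂ)‖ ^ 2
      ≤ (ρ ^ M) ^ 2 := by
    intro θ
    have heq : ∀ a : ι → Fin (M + 1),
        (∑ i, ((a i : ℕ) : ℤ) * m i) • θ - ∑ i, ((a i : ℕ) : ℤ) • t i =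
        ∑ i, ((a i : ℕ) : ℤ) • (m i • θ - t i) := by
      intro a
      rw [Finset.sum_smul, ← Finset.sum_sub_distrib]
      exact Finset.sum_congr rfl fun i _ ↦ by rw [smul_sub, mul_smul]
    simp_rw [heq]
    rw [← prod_half_one_add_toCircle_pow M fun i ↦ m i • θ - t i]
    gcongr
    obtain ⟨i, hi⟩ := hbad θ
    rw [norm_prod, ← Finset.mul_prod_erase _ _ (Finset.mem_univ i)]
    refine (mul_le_of_le_one_right (norm_nonneg _) (Finset.prod_le_one
      (fun _ _ ↦ norm_nonneg _) fun j _ ↦ ?_)).trans ?_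
    · rw [norm_pow]
      exact pow_le_one₀ (norm_nonneg _) (norm_half_one_add_toCircle_le_one _)
    · rw [norm_pow]
      exact pow_le_pow_left₀ (norm_nonneg _) (hρ _ hi) _
  have hint := integral_mono_of_nonneg (μ := (haarAddCircle : Measure UnitAddCircle))
    (Eventually.of_forall fun θ ↦ sq_nonneg _) (integrable_const ((ρ ^ M) ^ 2))
    (Eventually.of_forall hup)
  rw [integral_const, probReal_univ, one_smul] at hint
  have hcard : ((Finset.univ : Finset (ι → Fin (M + 1))).card : ℝ) =
      ((M : ℝ) + 1) ^ Fintype.card ι := by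
    simp
  rw [hcard] at hcs
  have hpos : 0 ≤ ((M : ℝ) + 1) ^ Fintype.card ι := by positivity
  nlinarith [mul_le_mul_of_nonneg_left (hlow.trans hint) hpos]

/-! ### Selective ultrafilters -/

lemma IsSelective.le_cofinite {p : Ultrafilter ℕ} (hp : IsSelective p) :
    (p : Filter ℕ) ≤ cofinite := by
  intro s hs
  have h : sᶜ.Finite := hs
  by_contra hns
  have h1 : sᶜ ∈ p := Ultrafilter.compl_mem_iff_notMem.2 hns
  obtain ⟨n, -, hn⟩ := (Ultrafilter.finite_biUnion_mem_iff h (f := p) (s := fun n ↦ {n})).1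
    (by rwa [Set.biUnion_of_singleton])
  exact hp.1 n hn

lemma IsSelective.tendsto_atTop {p : Ultrafilter ℕ} (hp : IsSelective p) :
    Tendsto id (p : Filter ℕ) atTop := by
  rw [← Nat.cofinite_eq_atTop]
  exact hp.le_cofinite

lemma IsSelective.eventually_ge {p : Ultrafilter ℕ} (hp : IsSelective p) (N : ℕ) :
    {n | N ≤ n} ∈ p := hp.tendsto_atTop (eventually_ge_atTop N)

/-- A selective ultrafilter is a P-point: countably many members have a pseudo-intersection in
`p`. -/
lemma IsSelective.exists_forall_ge_mem {p : Ultrafilter ℕ} (hp : IsSelective p)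
    (C : ℕ → Set ℕ) (hC : ∀ N, C N ∈ p) :
    ∃ B ∈ p, ∃ g : ℕ → ℕ, ∀ N, ∀ n ∈ B, g N ≤ n → n ∈ C N := by
  classical
  by_cases hall : {n | ∀ N, n ∈ C N} ∈ p
  · exact ⟨_, hall, fun _ ↦ 0, fun N n hn _ ↦ hn N⟩
  -- sort the points by the first of the sets that they avoid
  let f : ℕ → ℕ := fun n ↦ if h : ∃ N, n ∉ C N then Nat.find h else 0
  have hsome : {n | ∃ N, n ∉ C N} ∈ p := by
    have := Ultrafilter.compl_mem_iff_notMem.2 hall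
    filter_upwards [this] with n hn
    simpa using hn
  have hf : ∀ c, f ⁻¹' {c} ∉ p := by
    intro c hc
    have : (∅ : Set ℕ) ∈ p := by
      filter_upwards [hc, hsome, hC c] with n hn hn' hn''
      have h1 : f n = c := hn
      simp only [f, dif_pos hn'] at h1
      exact (h1 ▸ Nat.find_spec hn') hn''
    exact p.empty_notMem this
  obtain ⟨B, hB, hinj⟩ := hp.2 f hf
  have hfin : ∀ N, {n | n ∈ B ∧ f n ≤ N}.Finite := fun N ↦
    Set.Finite.of_finite_image ((Set.finite_Iic N).subset (by rintro _ ⟨n, hn, rfl⟩; exact hn.2))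
      (hinj.mono fun n hn ↦ hn.1)
  choose g hg using fun N ↦ (hfin N).bddAbove
  refine ⟨_, inter_mem hB hsome, fun N ↦ g N + 1, fun N n hn hgn ↦ ?_⟩
  by_contra hnC
  have hle : f n ≤ N := by
    have hex : ∃ N, n ∉ C N := ⟨N, hnC⟩
    simp only [f, dif_pos hex]
    exact Nat.find_min' hex hnC
  have := hg N ⟨hn.1, hle⟩
  have hgn' : g N + 1 ≤ n := hgn
  omega

/-- A selective ultrafilter has members that grow faster than a given function. Selectivity thins
out a partition into long intervals to one point in each; keeping only intervals of one parity
leaves a full interval between any two of the points. -/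
lemma IsSelective.exists_sparse {p : Ultrafilter ℕ} (hp : IsSelective p) (g : ℕ → ℕ) :
    ∃ B ∈ p, ∀ m ∈ B, ∀ n ∈ B, m < n → g m ≤ n := by
  classical
  obtain ⟨k, hk0, hk⟩ : ∃ k : ℕ → ℕ, k 0 = 0 ∧ ∀ i, k i < k (i + 1) ∧
      ∀ m ≤ k i, g m ≤ k (i + 1) := by
    refine ⟨fun i ↦ Nat.rec 0 (fun _ x ↦ x + 1 + ∑ m ∈ Finset.range (x + 1), g m) i, rfl,
      fun i ↦ ⟨by simp only; omega, fun m hm ↦ ?_⟩⟩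
    refine (Finset.single_le_sum (f := g) (fun _ _ ↦ Nat.zero_le _)
      (Finset.mem_range.2 (Nat.lt_succ_of_le hm))).trans (Nat.le_add_left _ _)
  have hmono : StrictMono k := strictMono_nat_of_lt_succ fun i ↦ (hk i).1
  -- `f n` is the index of the interval `[k i, k (i + 1))` containing `n`
  have hex : ∀ n, ∃ i, k i ≤ n ∧ n < k (i + 1) := by
    intro n
    have h : ∃ j, n < k j := ⟨n + 1, lt_of_lt_of_le (Nat.lt_succ_self n) (hmono.le_apply)⟩
    obtain ⟨j, hj⟩ : ∃ j, Nat.find h = j + 1 := by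
      refine Nat.exists_eq_succ_of_ne_zero fun h0 ↦ ?_
      have := Nat.find_spec h
      rw [h0, hk0] at this
      omega
    exact ⟨j, not_lt.1 (Nat.find_min h (by omega)), hj ▸ Nat.find_spec h⟩
  choose f hf1 hf2 using hex
  have hfib : ∀ c, f ⁻¹' {c} ∉ p := by
    intro c hc
    have : (∅ : Set ℕ) ∈ p := by
      filter_upwards [hc, hp.eventually_ge (k (c + 1))] with n hn hn'
      have h1 : f n = c := hn
      have h2 := hf2 n
      have h3 : k (c + 1) ≤ n := hn'
      rw [h1] at h2
      omega
    exact p.empty_notMem this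
  obtain ⟨B, hB, hinj⟩ := hp.2 f hfib
  have hpar : ∃ r, {n | f n % 2 = r} ∈ p := by
    rcases p.em fun n ↦ f n % 2 = 0 with h | h
    · exact ⟨0, h⟩
    · refine ⟨1, ?_⟩
      filter_upwards [h] with n hn
      omega
  obtain ⟨r, hr⟩ := hpar
  refine ⟨_, inter_mem hB hr, fun m hm n hn hmn ↦ ?_⟩
  have h1 : f m ≤ f n := by
    by_contra! hlt
    have := hmono.monotone (show f n + 1 ≤ f m from hlt)
    have := hf1 m
    have := hf2 n
    omega
  have h2 : f m ≠ f n := fun h ↦ hmn.ne (hinj hm.1 hn.1 h)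
  have h3 : f m + 2 ≤ f n := by
    have hm2 : f m % 2 = r := hm.2
    have hn2 : f n % 2 = r := hn.2
    omega
  exact ((hk (f m + 1)).2 m (hf2 m).le).trans ((hmono.monotone h3).trans (hf1 n))

lemma IsSelective.exists_diagonal {p : Ultrafilter ℕ} (hp : IsSelective p) (C₀ : Set ℕ)
    (hC₀ : C₀ ∈ p) (C : ℕ → Set ℕ) (hC : ∀ N, C N ∈ p) :
    ∃ B ∈ p, B ⊆ C₀ ∧ ∀ m ∈ B, ∀ n ∈ B, m < n → n ∈ C m := by
  obtain ⟨B₁, hB₁, g, hg⟩ := hp.exists_forall_ge_mem C hC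
  obtain ⟨B₂, hB₂, hs⟩ := hp.exists_sparse g
  exact ⟨_, inter_mem (inter_mem hB₁ hB₂) hC₀, fun n hn ↦ hn.2, fun m hm n hn hmn ↦
    hg m n hn.1.1 (hs m hm.1.2 n hn.1.2 hmn)⟩

/-- In a game where, at round `i` in state `s`, a set `G i s ∈ p` is offered, a number
`n ∈ G i s` is picked and the state becomes `step i s n`, the picks can be made so as to increase
and to form a member of `p`. The point is that only finitely many states can occur before time
`N`, so that the intersection of the sets offered in them is still in `p`. -/
lemma IsSelective.exists_strictMono_run {p : Ultrafilter ℕ} (hp : IsSelective p) {α : Type*}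
    (s₀ : α) (G : ℕ → α → Set ℕ) (hG : ∀ i s, G i s ∈ p) (step : ℕ → α → ℕ → α) :
    ∃ b : ℕ → ℕ, StrictMono b ∧ Set.range b ∈ p ∧ ∃ S : ℕ → α, S 0 = s₀ ∧
      ∀ i, b i ∈ G i (S i) ∧ S (i + 1) = step i (S i) (b i) := by
  classical
  -- the finite set of pairs (number of rounds, state) that can occur before time `N`
  let R : ℕ → Finset (ℕ × α) := fun N ↦ Nat.rec {(0, s₀)}
    (fun N F ↦ F ∪ F.image fun s ↦ (s.1 + 1, step s.1 s.2 N)) N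
  have hmem : ∀ N, (⋂ s ∈ R (N + 1), G s.1 s.2) ∈ p := fun N ↦
    (Filter.biInter_finset_mem _).2 fun s _ ↦ hG _ _
  obtain ⟨B, hB, hB0, hBC⟩ := hp.exists_diagonal (G 0 s₀) (hG 0 s₀) _ hmem
  have hinf : B.Infinite := fun hfin ↦ by
    have := hp.le_cofinite (hfin.compl_mem_cofinite)
    exact Ultrafilter.compl_mem_iff_notMem.1 this hB
  let b : ℕ → ℕ := Nat.nth (· ∈ B)
  have hbmono : StrictMono b := Nat.nth_strictMono hinf
  have hbB : ∀ i, b i ∈ B := fun i ↦ Nat.nth_mem_of_infinite hinf i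
  have hrange : Set.range b = B := Nat.range_nth_of_infinite hinf
  let S : ℕ → α := fun i ↦ Nat.rec s₀ (fun i s ↦ step i s (b i)) i
  have hmonoR : ∀ M N, M ≤ N → R M ⊆ R N := by
    intro M N h
    induction h with
    | refl => exact subset_rfl
    | step _ ih => exact ih.trans Finset.subset_union_left
  have hS : ∀ i, (i + 1, S (i + 1)) ∈ R (b i + 1) := by
    intro i
    have hprev : (i, S i) ∈ R (b i) := by
      induction i with
      | zero => exact hmonoR 0 _ (Nat.zero_le _) (Finset.mem_singleton_self _)
      | succ i ih =>
        exact hmonoR (b i + 1) _ (hbmono (Nat.lt_succ_self i)) (Finset.mem_union_right _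
          (Finset.mem_image_of_mem (fun s : ℕ × α ↦ (s.1 + 1, step s.1 s.2 (b i))) ih))
    exact Finset.mem_union_right _
      (Finset.mem_image_of_mem (fun s : ℕ × α ↦ (s.1 + 1, step s.1 s.2 (b i))) hprev)
  refine ⟨b, hbmono, hrange ▸ hB, S, rfl, fun i ↦ ⟨?_, rfl⟩⟩
  cases i with
  | zero => exact hB0 (hbB 0)
  | succ i =>
    exact Set.mem_iInter₂.1 (hBC _ (hbB i) _ (hbB (i + 1)) (hbmono (Nat.lt_succ_self i))) _ (hS i)

/-! ### Characters that respect limits along a selective ultrafilter -/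

/-- Along an ultrafilter, only the relations that hold almost everywhere obstruct the
approximation of prescribed values: with bounded coefficients there are finitely many relations. -/
lemma Ultrafilter.eventually_exists_addMonoidHom {X : Type*} [AddCommGroup X] [Module ℚ X]
    (q : Ultrafilter ℕ) {ι : Type*} [Fintype ι] (u : ι → ℕ → X) (t : ι → UnitAddCircle)
    (hrel : ∀ a : ι → ℤ, (∀ᶠ n in q, ∑ i, a i • u i n = 0) → ∑ i, a i • t i = 0)
    {ε : ℝ} (hε : 0 < ε) :
    ∀ᶠ n in q, ∃ φ : X →+ UnitAddCircle, ∀ i, ‖φ (u i n) - t i‖ < ε := by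
  classical
  obtain ⟨M, hM⟩ := exists_addMonoidHom_norm_sub_lt ι ε hε
  have hfin : ∀ᶠ n in q, ∀ a ∈ Fintype.piFinset fun _ : ι ↦ Finset.Icc (-(M : ℤ)) M,
      ∑ i, a i • u i n = 0 → ∑ i, a i • t i = 0 := by
    refine (Filter.eventually_all_finset _).2 fun a _ ↦ ?_
    by_cases ha : ∑ i, a i • t i = 0
    · exact Eventually.of_forall fun _ _ ↦ ha
    · filter_upwards [Ultrafilter.eventually_not.2 fun h ↦ ha (hrel a h)] with n hn h0
      exact absurd h0 hn
  filter_upwards [hfin] with n hn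
  exact hM (fun i ↦ u i n) t fun a ha h0 ↦
    hn a (Fintype.mem_piFinset.2 fun i ↦ Finset.mem_Icc.2 (abs_le.1 (ha i))) h0

/-- A character `φ₀` can be changed, by little on a given finite set, so as to take almost
prescribed values `s k` at the points `h k n` for almost all `n`. The hypothesis says that the
relations between the sequences `h k` modulo constants are compatible with these values. -/
lemma Ultrafilter.eventually_exists_addMonoidHom_near {X : Type*} [AddCommGroup X] [Module ℚ X]
    (q : Ultrafilter ℕ) (F : Finset X) (φ₀ : X →+ UnitAddCircle) {κ : Type*} [Fintype κ]
    (h : κ → ℕ → X) (s : κ → UnitAddCircle)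
    (hrel : ∀ (a : κ → ℤ) (c : X), (∀ᶠ n in q, ∑ k, a k • h k n = c) → ∑ k, a k • s k = φ₀ c)
    {ε : ℝ} (hε : 0 < ε) :
    ∀ᶠ n in q, ∃ φ : X →+ UnitAddCircle, (∀ v ∈ F, ‖φ v - φ₀ v‖ < ε) ∧
      ∀ k, ‖φ (h k n) - s k‖ < ε := by
  have := q.eventually_exists_addMonoidHom (ι := F ⊕ κ) (Sum.elim (fun v _ ↦ (v : X)) h)
    (Sum.elim (fun v ↦ φ₀ v) s) (fun a ha ↦ ?_) hε
  · filter_upwards [this] with n ⟨φ, hφ⟩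
    exact ⟨φ, fun v hv ↦ hφ (Sum.inl ⟨v, hv⟩), fun k ↦ hφ (Sum.inr k)⟩
  · simp only [Fintype.sum_sum_type, Sum.elim_inl, Sum.elim_inr] at ha ⊢
    rw [hrel (fun k ↦ a (Sum.inr k)) (-∑ v : F, a (Sum.inl v) • (v : X))
      (ha.mono fun n hn ↦ eq_neg_of_add_eq_zero_right hn), map_neg, map_sum]
    simp_rw [map_zsmul]
    exact add_neg_cancel _

lemma Ultrafilter.exists_tendsto {Y : Type*} [TopologicalSpace Y] [CompactSpace Y] {β : Type*}
    (q : Ultrafilter β) (f : β → Y) : ∃ y, Tendsto f q (𝓝 y) :=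
  ⟨(q.map f).lim, (q.map f).le_nhds_lim⟩

lemma Ultrafilter.exists_addMonoidHom_tendsto {X Y : Type*} [AddCommGroup X] [AddCommGroup Y]
    [TopologicalSpace Y] [ContinuousAdd Y] [CompactSpace Y] [T2Space Y] {β : Type*}
    (q : Ultrafilter β) (φ : β → X →+ Y) :
    ∃ ψ : X →+ Y, ∀ x, Tendsto (fun i ↦ φ i x) q (𝓝 (ψ x)) := by
  choose ψ hψ using fun x ↦ q.exists_tendsto fun i ↦ φ i x
  refine ⟨AddMonoidHom.mk' ψ fun x y ↦ ?_, hψ⟩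
  refine tendsto_nhds_unique (hψ (x + y)) ?_
  simpa only [map_add] using (hψ x).add (hψ y)

/-- The heart of the matter. Let `h k` be sequences such that no integer combination of them is
`p`-almost everywhere equal to a nonzero constant, and let `y` be injective. Then some character
sends every `h k` to a sequence with `p`-limit `0`, but does not send `y` to a null sequence.

The character is a limit of characters `φ i`, each approximating the previous one on a growing
finite set `F i` with precision `2⁻ⁱ`. Round `i` brings some value `φ (y m)`, `m ≥ i`, close to
`1 / 2`, and the values `φ (h k n)`, `k < i`, close to `0` for one number `n`; selectivity allows
these numbers `n` to form a member of `p`. -/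
theorem IsSelective.exists_addMonoidHom_tendsto_zero {p : Ultrafilter ℕ} (hp : IsSelective p)
    {X : Type*} [AddCommGroup X] [Module ℚ X] (h : ℕ → ℕ → X)
    (hnull : ∀ (i : ℕ) (a : Fin i → ℤ) (c : X), (∀ᶠ n in p, ∑ k, a k • h k n = c) → c = 0)
    (y : ℕ → X) (hy : Function.Injective y) :
    ∃ φ : X →+ UnitAddCircle, (∀ k, Tendsto (fun n ↦ φ (h k n)) p (𝓝 0)) ∧
      ∃ᶠ m in atTop, 1 / 4 ≤ ‖φ (y m)‖ := by
  classical
  let half : UnitAddCircle := ((1 / 2 : ℝ) : UnitAddCircle)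
  have hhalf : ‖half‖ = 1 / 2 := by
    have := AddCircle.norm_half_period_eq (1 : ℝ)
    rwa [abs_one] at this
  have hround : ∀ (i : ℕ) (s : (X →+ UnitAddCircle) × Finset X), ∃ G : Set ℕ, ∃ m : ℕ, G ∈ p ∧
      i ≤ m ∧ ∀ n, ∃ s' : (X →+ UnitAddCircle) × Finset X, n ∈ G →
        s.2 ⊆ s'.2 ∧ y m ∈ s'.2 ∧ (∀ k < i, h k n ∈ s'.2) ∧
        (∀ v ∈ s.2, ‖s'.1 v - s.1 v‖ ≤ (1 / 2) ^ i) ∧ ‖s'.1 (y m) - half‖ ≤ (1 / 2) ^ i ∧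
        ∀ k < i, ‖s'.1 (h k n)‖ ≤ (1 / 2) ^ i := by
    rintro i ⟨φ₀, F⟩
    have hε : (0 : ℝ) < (1 / 2) ^ i / 2 := by positivity
    -- a small change of `φ₀` moves the value at some `y m` close to `1 / 2`
    have h1 := p.eventually_exists_addMonoidHom_near F φ₀ (fun _ : Unit ↦ y) (fun _ ↦ half)
      (fun a c hac ↦ ?_) hε
    · obtain ⟨m, ⟨φ₁, hφ₁, hφ₁y⟩, him⟩ := (h1.and (hp.eventually_ge i)).exists
      have h2 := p.eventually_exists_addMonoidHom_near (insert (y m) F) φ₁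
        (fun k : Fin i ↦ h k) (fun _ ↦ 0) (fun a c hac ↦ ?_) hε
      · refine ⟨_, m, h2, him, fun n ↦ ?_⟩
        by_cases hn : ∃ φ : X →+ UnitAddCircle, (∀ v ∈ insert (y m) F,
            ‖φ v - φ₁ v‖ < (1 / 2) ^ i / 2) ∧ ∀ k : Fin i, ‖φ (h k n) - 0‖ < (1 / 2) ^ i / 2
        · obtain ⟨φ, hφ, hφh⟩ := hn
          refine ⟨(φ, insert (y m) F ∪ (Finset.range i).image fun k ↦ h k n), fun _ ↦
            ⟨(Finset.subset_insert _ _).trans Finset.subset_union_left,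
              Finset.mem_union_left _ (Finset.mem_insert_self _ _), fun k hk ↦
              Finset.mem_union_right _ (Finset.mem_image_of_mem _ (Finset.mem_range.2 hk)),
              fun v hv ↦ ?_, ?_, fun k hk ↦ ?_⟩⟩
          · have e1 := hφ v (Finset.mem_insert_of_mem hv)
            have e2 := hφ₁ v hv
            have e3 := norm_sub_le_norm_sub_add_norm_sub (φ v) (φ₁ v) (φ₀ v)
            dsimp only
            linarith
          · have e1 := hφ (y m) (Finset.mem_insert_self _ _)
            have e2 := hφ₁y ()
            have e3 := norm_sub_le_norm_sub_add_norm_sub (φ (y m)) (φ₁ (y m)) half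
            dsimp only
            linarith
          · have e1 := hφh ⟨k, hk⟩
            rw [sub_zero] at e1
            dsimp only at e1 ⊢
            linarith
        · exact ⟨(φ₀, F), fun hn' ↦ absurd hn' hn⟩
      · rw [hnull i a c hac]
        simp
    · -- the only relation between `y` and constants is the trivial one, as `y` is injective
      simp only [Finset.univ_unique, Finset.sum_singleton] at hac ⊢
      obtain ⟨n, hn⟩ := hac.exists
      obtain ⟨n', hn', hnn'⟩ := (hac.and (hp.eventually_ge (n + 1))).exists
      have ha : a default = 0 := by
        by_contra hne
        have h3 : a default • (y n' - y n) = 0 := by rw [smul_sub, hn', hn, sub_self]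
        rw [← Int.cast_smul_eq_zsmul ℚ, smul_eq_zero, Int.cast_eq_zero, or_iff_right hne,
          sub_eq_zero] at h3
        have := hy h3
        have : n + 1 ≤ n' := hnn'
        omega
      rw [ha, zero_smul] at hn ⊢
      rw [← hn, map_zero]
  choose G m hG hm step hstep using hround
  obtain ⟨b, hb, hbp, S, -, hS⟩ := hp.exists_strictMono_run (0, ∅) G hG step
  have hrun := fun i ↦ (hS i).2 ▸ hstep i (S i) (b i) (hS i).1
  obtain ⟨φ, hφ⟩ := p.exists_addMonoidHom_tendsto fun i ↦ (S i).1
  have hsub : ∀ i j, i ≤ j → (S i).2 ⊆ (S j).2 := fun i j hij ↦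
    monotone_nat_of_le_succ (f := fun i ↦ (S i).2) (fun i ↦ (hrun i).1) hij
  have hcauchy : ∀ i j, i ≤ j → ∀ v ∈ (S i).2,
      ‖(S j).1 v - (S i).1 v‖ ≤ 2 * (1 / 2) ^ i - 2 * (1 / 2) ^ j := by
    intro i j hij v hv
    induction j, hij using Nat.le_induction with
    | base => simp
    | succ j hij ih =>
      have e1 := (hrun j).2.2.2.1 v (hsub i j hij hv)
      have e2 := norm_sub_le_norm_sub_add_norm_sub ((S (j + 1)).1 v) ((S j).1 v) ((S i).1 v)
      rw [pow_succ]
      linarith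
  have hlim : ∀ i, ∀ v ∈ (S i).2, ‖φ v - (S i).1 v‖ ≤ 2 * (1 / 2) ^ i := by
    intro i v hv
    refine le_of_tendsto ((hφ v).sub_const ((S i).1 v)).norm ?_
    filter_upwards [hp.eventually_ge i] with j hj
    have := hcauchy i j hj v hv
    have : (0 : ℝ) < 2 * (1 / 2) ^ j := by positivity
    linarith
  refine ⟨φ, fun k ↦ ?_, frequently_atTop.2 fun N ↦ ?_⟩
  · rw [tendsto_zero_iff_norm_tendsto_zero, Metric.tendsto_nhds]
    intro ε hε
    have hgeom : Tendsto (fun i : ℕ ↦ 2 * (1 / 2 : ℝ) ^ i) atTop (𝓝 0) := by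
      simpa using (tendsto_pow_atTop_nhds_zero_of_lt_one (r := (1 / 2 : ℝ)) (by norm_num)
        (by norm_num)).const_mul 2
    obtain ⟨i₀, hi₀⟩ := eventually_atTop.1 (hgeom.eventually_lt_const hε)
    filter_upwards [hbp, hp.eventually_ge (b (max i₀ (k + 1)))] with n ⟨i, hi⟩ hn
    subst hi
    have hi : max i₀ (k + 1) ≤ i := hb.le_iff_le.1 hn
    have hki : k < i := by omega
    have e1 := (hrun i).2.2.2.2.2 k hki
    have e2 := hlim (i + 1) _ ((hrun i).2.2.1 k hki)
    have e3 := hi₀ i (by omega)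
    have e4 := norm_le_norm_add_norm_sub' (φ (h k (b i))) ((S (i + 1)).1 (h k (b i)))
    rw [pow_succ] at e2
    rw [dist_zero_right, norm_norm]
    linarith
  · set i := N + 4
    refine ⟨m i (S i), (Nat.le_add_right N 4).trans (hm i (S i)), ?_⟩
    have e1 := (hrun i).2.2.2.2.1
    have e2 := hlim (i + 1) _ (hrun i).2.1
    have e3 := norm_le_norm_add_norm_sub (φ (y (m i (S i)))) half
    have e4 := norm_sub_le_norm_sub_add_norm_sub (φ (y (m i (S i))))
      ((S (i + 1)).1 (y (m i (S i)))) half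
    have e5 : (1 / 2 : ℝ) ^ i ≤ (1 / 2) ^ 4 :=
      pow_le_pow_of_le_one (by norm_num) (by norm_num) (Nat.le_add_left 4 N)
    rw [pow_succ] at e2
    norm_num at e5
    linarith

/-! ### The universal rational solenoid -/

/-- The universal rational solenoid, encoded as the group `Hom(ℚ, ℝ/ℤ)` of all characters of the
discrete group `ℚ`. It is a compact rational vector space, and `ℚ`-linear maps from `X` to it
correspond to additive maps from `X` to `ℝ/ℤ`. -/
def Solenoid : Type := ℚ →+ UnitAddCircle

namespace Solenoid

instance : AddCommGroup Solenoid := inferInstanceAs (AddCommGroup (ℚ →+ UnitAddCircle))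

instance : FunLike Solenoid ℚ UnitAddCircle :=
  inferInstanceAs (FunLike (ℚ →+ UnitAddCircle) ℚ UnitAddCircle)

instance : AddMonoidHomClass Solenoid ℚ UnitAddCircle :=
  inferInstanceAs (AddMonoidHomClass (ℚ →+ UnitAddCircle) ℚ UnitAddCircle)

@[ext] lemma ext {s t : Solenoid} (h : ∀ q, s q = t q) : s = t := DFunLike.ext s t h

@[simp] lemma add_apply (s t : Solenoid) (q : ℚ) : (s + t) q = s q + t q := rfl

@[simp] lemma zero_apply (q : ℚ) : (0 : Solenoid) q = 0 := rfl

/-- Rational scalars act by dilating the argument. -/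
instance : SMul ℚ Solenoid := ⟨fun r s ↦ AddMonoidHom.comp s (AddMonoidHom.mulRight r)⟩

@[simp] lemma smul_apply (r : ℚ) (s : Solenoid) (q : ℚ) : (r • s) q = s (q * r) := rfl

instance : Module ℚ Solenoid where
  one_smul s := by ext; simp
  mul_smul a b s := by ext; simp [mul_assoc]
  smul_zero a := by ext; simp
  smul_add a s t := by ext; simp
  add_smul a b s := by ext; simp [mul_add]
  zero_smul s := by ext; simp

/-- The topology of pointwise convergence. -/
instance : TopologicalSpace Solenoid :=
  TopologicalSpace.induced (fun s q ↦ s q) (inferInstanceAs (TopologicalSpace (ℚ → UnitAddCircle)))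

lemma isClosedEmbedding_coe : IsClosedEmbedding fun (s : Solenoid) (q : ℚ) ↦ s q := by
  refine ⟨⟨⟨rfl⟩, DFunLike.coe_injective⟩, ?_⟩
  have : Set.range (fun (s : Solenoid) (q : ℚ) ↦ s q) =
      ⋂ (a : ℚ) (b : ℚ), {f | f (a + b) = f a + f b} := by
    ext f
    simp only [Set.mem_range, Set.mem_iInter]
    refine ⟨?_, fun h ↦ ⟨AddMonoidHom.mk' f h, rfl⟩⟩
    rintro ⟨s, rfl⟩ a b
    exact map_add s a b
  rw [this]
  exact isClosed_iInter fun a ↦ isClosed_iInter fun b ↦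
    isClosed_eq (continuous_apply (a + b)) (by fun_prop)

instance : CompactSpace Solenoid := isClosedEmbedding_coe.compactSpace

instance : T2Space Solenoid := isClosedEmbedding_coe.isEmbedding.t2Space

lemma tendsto_iff {β : Type*} {l : Filter β} {f : β → Solenoid} {s : Solenoid} :
    Tendsto f l (𝓝 s) ↔ ∀ q, Tendsto (fun b ↦ f b q) l (𝓝 (s q)) := by
  rw [isClosedEmbedding_coe.isEmbedding.tendsto_nhds_iff, tendsto_pi_nhds]
  rfl

lemma continuous_apply (q : ℚ) : Continuous fun s : Solenoid ↦ s q :=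
  (_root_.continuous_apply q).comp isClosedEmbedding_coe.continuous

instance : IsTopologicalAddGroup Solenoid :=
  topologicalAddGroup_induced
    (AddMonoidHom.mk' (fun (s : Solenoid) (q : ℚ) ↦ s q) fun _ _ ↦ rfl)

instance : ContinuousConstSMul ℚ Solenoid where
  continuous_const_smul r := by
    rw [isClosedEmbedding_coe.isEmbedding.continuous_iff]
    exact continuous_pi fun q ↦ continuous_apply (q * r)

/-- The `ℚ`-linear map to the solenoid that corresponds to a homomorphism to the circle. -/
def liftHom {X : Type*} [AddCommGroup X] [Module ℚ X] (φ : X →+ UnitAddCircle) :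
    X →ₗ[ℚ] Solenoid where
  toFun x := AddMonoidHom.mk' (fun q ↦ φ (q • x)) fun a b ↦ by rw [add_smul, map_add]
  map_add' x y := by
    ext q
    exact (congrArg φ (smul_add q x y)).trans (map_add φ _ _)
  map_smul' r x := by
    ext q
    exact congrArg φ (smul_smul q r x)

@[simp] lemma liftHom_apply {X : Type*} [AddCommGroup X] [Module ℚ X] (φ : X →+ UnitAddCircle)
    (x : X) (q : ℚ) : liftHom φ x q = φ (q • x) := rfl

instance : Nontrivial Solenoid := by
  refine ⟨⟨liftHom (QuotientAddGroup.mk' _ : ℝ →+ UnitAddCircle) (1 / 2), 0, fun h ↦ ?_⟩⟩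
  have h1 := DFunLike.congr_fun h 1
  rw [liftHom_apply, one_smul, zero_apply] at h1
  have h2 := AddCircle.norm_half_period_eq (1 : ℝ)
  have h3 : (((1 / 2 : ℝ)) : UnitAddCircle) = 0 := h1
  rw [h3] at h2
  norm_num at h2

end Solenoid

/-! ### Iterated limits of evaluations -/

section IterLimit

variable (p : Ultrafilter ℕ) (V : Type*) [AddCommGroup V] [Module ℚ V]

/-- The canonical map from `V` to functions on its dual `V →ₗ[ℚ] Solenoid`. -/
def evalSolenoid : V →ₗ[ℚ] ((V →ₗ[ℚ] Solenoid) → Solenoid) where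
  toFun v φ := φ v
  map_add' v w := by ext1 φ; exact map_add φ v w
  map_smul' r v := by ext1 φ; exact map_smul φ r v

variable {V}

/-- The functions on the dual of `V` obtained from evaluations at points of `V` by iterating
pointwise limits of sequences along `p`. -/
inductive IsIterLimit : ((V →ₗ[ℚ] Solenoid) → Solenoid) → Prop
  | eval (v : V) : IsIterLimit (evalSolenoid V v)
  | lim (f : ℕ → (V →ₗ[ℚ] Solenoid) → Solenoid) (y : (V →ₗ[ℚ] Solenoid) → Solenoid)
      (hf : ∀ n, IsIterLimit (f n)) (h : Tendsto f p (𝓝 y)) : IsIterLimit y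

variable {p}

lemma IsIterLimit.add {y z : (V →ₗ[ℚ] Solenoid) → Solenoid} (hy : IsIterLimit p y)
    (hz : IsIterLimit p z) : IsIterLimit p (y + z) := by
  induction hy with
  | eval v =>
    induction hz with
    | eval w => exact map_add (evalSolenoid V) v w ▸ .eval (v + w)
    | lim f z _ h ih => exact .lim _ _ ih (h.const_add _)
  | lim f y _ h ih => exact .lim _ _ ih (h.add_const _)

lemma IsIterLimit.smul (r : ℚ) {y : (V →ₗ[ℚ] Solenoid) → Solenoid} (hy : IsIterLimit p y) :
    IsIterLimit p (r • y) := by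
  induction hy with
  | eval v => exact map_smul (evalSolenoid V) r v ▸ .eval (r • v)
  | lim f y _ h ih => exact .lim _ _ ih (h.const_smul r)

variable (p V)

/-- The `p`-closure of `V` in its Bohr compactification: the rational vector space of iterated
`p`-limits of evaluations, with the topology of pointwise convergence. -/
def iterLimit : Submodule ℚ ((V →ₗ[ℚ] Solenoid) → Solenoid) where
  carrier := {y | IsIterLimit p y}
  add_mem' hy hz := hy.add hz
  zero_mem' := map_zero (evalSolenoid V) ▸ .eval 0
  smul_mem' r _ hy := hy.smul r

instance : ContinuousConstSMul ℚ (iterLimit p V) where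
  continuous_const_smul r := (continuous_subtype_val.const_smul r).subtype_mk _

/-- The canonical map from `V` to its `p`-closure. -/
def evalIterLimit : V →ₗ[ℚ] iterLimit p V :=
  (evalSolenoid V).codRestrict (iterLimit p V) fun v ↦ .eval v

variable {V}

lemma evalIterLimit_injective : Function.Injective (evalIterLimit p (V := V)) := by
  rw [injective_iff_map_eq_zero]
  intro v hv
  by_contra hne
  obtain ⟨l, hl⟩ := Module.exists_dual_forall_apply_ne_zero (K := ℚ) (fun _ : Unit ↦ v)
    fun _ ↦ hne
  obtain ⟨s, hs⟩ := exists_ne (0 : Solenoid)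
  have h1 : l v • s = 0 := congrFun (congrArg Subtype.val hv) (LinearMap.toSpanSingleton ℚ _ s ∘ₗ l)
  exact smul_ne_zero (hl ()) hs h1

lemma iterLimit.exists_tendsto (u : ℕ → iterLimit p V) : ∃ x, Tendsto u p (𝓝 x) := by
  obtain ⟨y, hy⟩ := p.exists_tendsto fun n ↦ (u n : (V →ₗ[ℚ] Solenoid) → Solenoid)
  exact ⟨⟨y, .lim _ y (fun n ↦ (u n).2) hy⟩, tendsto_subtype_rng.2 hy⟩

/-- A linear map `Φ` on the `p`-closure restricts to a character of `V`, at which the function `x`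
has a value. This value is `Φ x`, provided that `Φ` respects countably many `p`-limits, namely
those used in building `x`. -/
lemma iterLimit.exists_countable (x : iterLimit p V) :
    ∃ L : Set ((ℕ → iterLimit p V) × iterLimit p V), L.Countable ∧
      (∀ l ∈ L, Tendsto l.1 p (𝓝 l.2)) ∧
      ∀ Φ : iterLimit p V →ₗ[ℚ] Solenoid,
        (∀ l ∈ L, Tendsto (fun n ↦ Φ (l.1 n)) p (𝓝 (Φ l.2))) →
        (x : (V →ₗ[ℚ] Solenoid) → Solenoid) (Φ ∘ₗ evalIterLimit p V) = Φ x := by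
  obtain ⟨y, hy⟩ := x
  induction hy with
  | eval v => exact ⟨∅, Set.countable_empty, by simp, fun Φ _ ↦ rfl⟩
  | lim f y hf h ih =>
    choose L hLc hLt hL using ih
    refine ⟨insert (fun n ↦ ⟨f n, hf n⟩, ⟨y, .lim f y hf h⟩) (⋃ n, L n),
      (Set.countable_iUnion hLc).insert _, ?_, fun Φ hΦ ↦ ?_⟩
    · rintro l (rfl | hl)
      · exact tendsto_subtype_rng.2 h
      · obtain ⟨n, hn⟩ := Set.mem_iUnion.1 hl
        exact hLt n l hn
    · refine tendsto_nhds_unique (tendsto_pi_nhds.1 h _) ?_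
      refine (hΦ _ (Set.mem_insert _ _)).congr fun n ↦ ?_
      exact (hL n Φ fun l hl ↦ hΦ l (Set.mem_insert_of_mem _ (Set.mem_iUnion.2 ⟨n, hl⟩))).symm

lemma exists_injective_tendsto_of_frequently_ne {Y : Type*} [TopologicalSpace Y] [T1Space Y]
    {w : ℕ → Y} {x : Y} (hw : Tendsto w atTop (𝓝 x)) (hne : ∃ᶠ n in atTop, w n ≠ x) :
    ∃ σ : ℕ → ℕ, Function.Injective (w ∘ σ) ∧ Tendsto (w ∘ σ) atTop (𝓝 x) := by
  have hinf : (Set.range w \ {x}).Infinite := fun hfin ↦ by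
    refine hne ?_
    filter_upwards [hw (hfin.isClosed.isOpen_compl.mem_nhds (by simp))] with n hn hn'
    exact hn ⟨⟨n, rfl⟩, hn'⟩
  choose σ hσ using fun m ↦ (hinf.natEmbedding _ m).2.1
  have hinj : Function.Injective (w ∘ σ) := fun a b hab ↦ by
    simp only [Function.comp_apply, hσ] at hab
    exact (hinf.natEmbedding _).injective (Subtype.ext hab)
  exact ⟨σ, hinj, hw.comp hinj.of_comp.nat_tendsto_atTop⟩

theorem iterLimit.noNontrivialConvergentSeq {p : Ultrafilter ℕ} (hp : IsSelective p) :
    NoNontrivialConvergentSeq (iterLimit p V) := by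
  intro u x hu
  by_contra hcon
  have hu0 : Tendsto (fun n ↦ u n - x) atTop (𝓝 0) := by
    simpa using hu.sub_const x
  obtain ⟨σ, hinj, hσ⟩ := exists_injective_tendsto_of_frequently_ne hu0
    (fun h ↦ hcon (h.mono fun n hn ↦ sub_eq_zero.1 (not_not.1 hn)))
  set y : ℕ → iterLimit p V := (fun n ↦ u n - x) ∘ σ
  choose L hLc hLt hL using fun m ↦ iterLimit.exists_countable p (y m)
  -- all rational multiples of the countably many null sequences that have to be respected
  obtain ⟨h, hh⟩ := ((Set.countable_univ (α := ℚ)).image2 ((Set.countable_iUnion hLc).insert (0, 0))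
    fun q l n ↦ q • (l.1 n - l.2)).exists_eq_range
      (Set.Nonempty.image2 Set.univ_nonempty (Set.insert_nonempty _ _))
  have hnull : ∀ k, Tendsto (h k) p (𝓝 0) := by
    intro k
    obtain ⟨q, -, l, hl, hk⟩ := hh.symm ▸ Set.mem_range_self (f := h) k
    have hlt : Tendsto l.1 p (𝓝 l.2) := by
      rcases hl with rfl | hl
      · exact tendsto_const_nhds
      · obtain ⟨m, hm⟩ := Set.mem_iUnion.1 hl
        exact hLt m l hm
    rw [← hk]
    simpa using (hlt.sub_const l.2).const_smul q
  obtain ⟨φ, hφ, hfar⟩ := hp.exists_addMonoidHom_tendsto_zero h (fun i a c hac ↦ by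
    refine tendsto_nhds_unique_of_eventuallyEq tendsto_const_nhds
      (f := fun _ ↦ c) (g := fun n ↦ ∑ k, a k • h k n) (l := p) ?_ (hac.mono fun n hn ↦ hn.symm)
    have := tendsto_finsetSum (Finset.univ : Finset (Fin i)) fun k _ ↦
      (hnull (k : ℕ)).const_smul (a k)
    simpa using this) y hinj
  have hval : ∀ m, (y m : (V →ₗ[ℚ] Solenoid) → Solenoid)
      (Solenoid.liftHom φ ∘ₗ evalIterLimit p V) = Solenoid.liftHom φ (y m) := by
    intro m
    refine hL m _ fun l hl ↦ Solenoid.tendsto_iff.2 fun q ↦ ?_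
    obtain ⟨k, hk⟩ : (fun n ↦ q • (l.1 n - l.2)) ∈ Set.range h := hh ▸
      Set.mem_image2_of_mem (Set.mem_univ q) (Set.mem_insert_of_mem _ (Set.mem_iUnion.2 ⟨m, hl⟩))
    have := hφ k
    rw [hk] at this
    simp only [smul_sub, map_sub] at this
    simpa using this.add_const (φ (q • l.2))
  have hy0 : Tendsto (fun m ↦ φ (y m)) atTop (𝓝 0) := by
    have h1 := tendsto_pi_nhds.1 (tendsto_subtype_rng.1 hσ)
      (Solenoid.liftHom φ ∘ₗ evalIterLimit p V)
    have h2 := Solenoid.tendsto_iff.1 (h1.congr hval) 1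
    simpa using h2
  refine hfar ?_
  filter_upwards [hy0.norm.eventually_lt_const (u := 1 / 4) (by simp)] with m hm
  exact not_le.2 hm

/-! ### Cardinality -/

open Cardinal in
/-- Iterated limits are described by well-founded trees with countable branching, whose leaves are
labelled by elements of `V`; there are at most continuum many of these. -/
lemma iterLimit.mk_le {V : Type} [AddCommGroup V] [Module ℚ V] (hV : #V ≤ 𝔠) :
    #(iterLimit p V) ≤ 𝔠 := by
  -- `some v` labels a leaf, `none` a node with one branch for each natural number
  let β : Option V → Type := fun o ↦ o.elim ℕ fun _ ↦ Empty
  let ev : WType β → (V →ₗ[ℚ] Solenoid) → Solenoid := WType.elim _ fun x ↦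
    match x with
    | ⟨some v, _⟩ => evalSolenoid V v
    | ⟨none, f⟩ => (p.map f).lim
  have hsub : (iterLimit p V : Set ((V →ₗ[ℚ] Solenoid) → Solenoid)) ⊆ Set.range ev := by
    intro y hy
    induction hy with
    | eval v => exact ⟨WType.mk (some v) Empty.elim, rfl⟩
    | lim f y _ h ih =>
      choose g hg using ih
      refine ⟨WType.mk none g, ?_⟩
      refine tendsto_nhds_unique ((p.map fun n ↦ ev (g n)).le_nhds_lim) ?_
      simp_rw [hg]
      exact h
  have hW : #(WType β) ≤ 𝔠 := by
    refine WType.cardinalMk_le_of_le ?_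
    calc sum (fun o ↦ 𝔠 ^ #(β o)) ≤ sum fun _ : Option V ↦ 𝔠 := by
          refine sum_le_sum _ _ fun o ↦ ?_
          cases o with
          | none => simp [β]
          | some v => simpa [β] using one_le_aleph0.trans aleph0_le_continuum
      _ = #(Option V) * 𝔠 := sum_const' _ _
      _ ≤ 𝔠 * 𝔠 := by
          gcongr
          rw [mk_option]
          exact add_le_of_le aleph0_le_continuum hV (one_le_aleph0.trans aleph0_le_continuum)
      _ = 𝔠 := continuum_mul_self
  exact ((mk_le_mk_of_subset hsub).trans mk_range_le).trans hW

end IterLimit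

/-! ### The topology on the real line -/

open Cardinal in
theorem mainTheorem3 (p : Ultrafilter ℕ) (hp : IsSelective p) :
    ∃ τ : TopologicalSpace ℝ,
      @IsTopologicalAddGroup ℝ τ _ ∧ @T2Space ℝ τ ∧
        @IsPCompactSpace ℝ τ p ∧ @NoNontrivialConvergentSeq ℝ τ := by
  have hge : 𝔠 ≤ #(iterLimit p ℝ) :=
    mk_real ▸ mk_le_of_injective (evalIterLimit_injective p (V := ℝ))
  have hcard : #(iterLimit p ℝ) = 𝔠 := le_antisymm (iterLimit.mk_le p mk_real.le) hge
  have hrank : Module.rank ℚ (iterLimit p ℝ) = 𝔠 := by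
    rw [Module.Free.rank_eq_mk_of_infinite_lt ℚ (iterLimit p ℝ), hcard]
    simpa [hcard] using aleph0_lt_continuum
  obtain ⟨e⟩ : Nonempty (ℝ ≃ₗ[ℚ] iterLimit p ℝ) :=
    Module.nonempty_linearEquiv_iff_rank_eq.2 (by rw [hrank, Real.rank_rat_real])
  let τ : TopologicalSpace ℝ := TopologicalSpace.induced e inferInstance
  have hτ : @IsInducing ℝ (iterLimit p ℝ) τ _ e := @IsInducing.mk _ _ τ _ _ rfl
  have hlim : ∀ (l : Filter ℕ) (u : ℕ → ℝ) (x : ℝ), Tendsto u l (@nhds ℝ τ x) ↔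
      Tendsto (e ∘ u) l (𝓝 (e x)) := fun l u x ↦
    @IsInducing.tendsto_nhds_iff _ _ _ _ τ _ _ _ _ hτ
  refine ⟨τ, topologicalAddGroup_induced e, ?_, fun u ↦ ?_, fun u x hu ↦ ?_⟩
  · exact @IsEmbedding.t2Space _ _ τ _ _ _ (@IsEmbedding.mk _ _ τ _ _ hτ e.injective)
  · obtain ⟨y, hy⟩ := iterLimit.exists_tendsto p (e ∘ u)
    obtain ⟨x, rfl⟩ := e.surjective y
    exact ⟨x, fun U hU hx ↦ (hlim p u x).2 hy (@IsOpen.mem_nhds ℝ τ x U hU hx)⟩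
  · have := iterLimit.noNontrivialConvergentSeq hp (e ∘ u) (e x) ((hlim atTop u x).1 hu)
    exact this.mono fun n hn ↦ e.injective hn
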